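/- For complex numbers $a,q$ put $(a;q)_n=\prod_{j=1}^{n}(1-aq^{j-1})$ for integers $n\ge 0$ and, when $|q|<1$, $(a;q)_\infty=\prod_{n=0}^{\infty}(1-aq^{n})$ and $(a_1,a_2,a_3;q)_\infty=(a_1;q)_\infty(a_2;q)_\infty(a_3;q)_\infty$. For integers $0\le k\le n$ let ${n\brack k}_q=\dfrac{(q;q)_n}{(q;q)_k(q;q)_{n-k}}$. Then for every complex number $q$ with $|q|<1$ the following series over $n$ converges absolutely and $$\sum_{n=0}^{\infty}\ \sum_{m=-\lfloor n/2\rfloor}^{\lfloor n/2\rfloor}\frac{(-1)^m\,q^{2n^2+m(9m+1)/2}}{(q^2;q^2)_{2n}}{2n\brack n-2m}_{q^2}=\frac{(q^{12},q^{13},q^{25};q^{25})_\infty}{(q^2;q^2)_\infty}.$$ -/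

import Mathlib

/-- The finite `q`-shifted factorial `(a; q)_n = ∏_{j=1}^{n} (1 - a q^{j-1})`
(the empty product `1` for `n = 0`). -/
def qPoch (a q : ℂ) (n : ℕ) : ℂ :=
  ∏ j ∈ Finset.range n, (1 - a * q ^ j)

/-- The infinite `q`-shifted factorial `(a; q)_∞ = ∏_{n=0}^{∞} (1 - a q^n)`. -/
noncomputable def qPochInf (a q : ℂ) : ℂ :=
  ∏' n : ℕ, (1 - a * q ^ n)

/-- The `q`-binomial coefficient `(q; q)_n / ((q; q)_k (q; q)_{n-k})` with integer lower entry `k`;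
it is `0` unless `0 ≤ k ≤ n`. -/
noncomputable def qBinom (q : ℂ) (n : ℕ) (k : ℤ) : ℂ :=
  if 0 ≤ k ∧ k ≤ n then
    qPoch q q n / (qPoch q q k.toNat * qPoch q q (n - k.toNat))
  else 0

/-- For `|q| < 1` the infinite product defining `(a; q)_∞` converges. -/
theorem multipliable_qPochInf (a q : ℂ) (hq : ‖q‖ < 1) :
    Multipliable fun n : ℕ => (1 - a * q ^ n) := by
  have h : Summable fun n : ℕ => ‖-(a * q ^ n)‖ := by
    simpa [norm_mul, norm_pow] using
      (summable_geometric_of_lt_one (norm_nonneg q) hq).mul_left ‖a‖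
  simpa [sub_eq_add_neg] using multipliable_one_add_of_summable h

/-! Put p = q². Cancelling (p;p)_{2n} turns the summand into a theta weight in m times
p^(n²)/((p;p)_{n-2m} (p;p)_{n+2m}). The double series is absolutely summable, so n may be summed
first: by the Durfee rectangle identity (`hasSum_bailey_weight`, r = 2m) this gives p^(4m²)/(p;p)_∞.
The factor q^(8m²) changes the theta series of base q⁹ into one of base q²⁵, which the Jacobi triple
product (`hasSum_thetaTerm`) evaluates. Both classical identities are limits, by dominated
convergence, of finite forms proved by induction with the q-Pascal rules. -/

open Filter Topology

/-! ### Gaussian binomials and q-Pascal rules -/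

/-- The Gaussian binomial coefficient, defined by the `q`-Pascal recursion. -/
def gauss (p : ℂ) : ℕ → ℕ → ℂ
  | _, 0 => 1
  | 0, _ + 1 => 0
  | n + 1, k + 1 => gauss p n (k + 1) + p ^ (n - k) * gauss p n k

theorem gauss_zero_right (p : ℂ) (n : ℕ) : gauss p n 0 = 1 := by
  cases n <;> rfl

theorem gauss_succ_succ (p : ℂ) (n k : ℕ) :
    gauss p (n + 1) (k + 1) = gauss p n (k + 1) + p ^ (n - k) * gauss p n k := rfl

theorem gauss_eq_zero_of_lt (p : ℂ) {n k : ℕ} (h : n < k) : gauss p n k = 0 := by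
  induction n generalizing k with
  | zero => obtain ⟨k, rfl⟩ := Nat.exists_eq_succ_of_ne_zero h.ne'; rfl
  | succ n ih =>
    obtain ⟨k, rfl⟩ := Nat.exists_eq_succ_of_ne_zero (Nat.ne_zero_of_lt h)
    rw [Nat.succ_eq_add_one, gauss_succ_succ, ih (by omega), ih (by omega)]
    simp

theorem gauss_self (p : ℂ) (n : ℕ) : gauss p n n = 1 := by
  induction n with
  | zero => rfl
  | succ n ih => rw [gauss_succ_succ, gauss_eq_zero_of_lt p (Nat.lt_succ_self n), ih]; simp

theorem qPoch_self_succ (p : ℂ) (n : ℕ) :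
    qPoch p p (n + 1) = qPoch p p n * (1 - p ^ (n + 1)) := by
  rw [qPoch, Finset.prod_range_succ, pow_succ']
  rfl

theorem gauss_mul_qPoch (p : ℂ) (m k : ℕ) :
    gauss p (m + k) k * (qPoch p p k * qPoch p p m) = qPoch p p (m + k) := by
  induction k generalizing m with
  | zero => simp [gauss_zero_right, qPoch]
  | succ k ihk =>
    induction m with
    | zero => simp [gauss_self, qPoch]
    | succ m ihm =>
      have h1 := ihk (m + 1)
      have e : m + 1 + k = m + (k + 1) := by omega
      rw [e] at h1
      rw [show m + 1 + (k + 1) = m + (k + 1) + 1 by omega, gauss_succ_succ,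
        qPoch_self_succ p (m + (k + 1)), show m + (k + 1) - k = m + 1 by omega]
      have h3 := qPoch_self_succ p m
      have h4 := qPoch_self_succ p k
      calc _ = gauss p (m + (k + 1)) (k + 1) * (qPoch p p (k + 1) * qPoch p p m) * (1 - p ^ (m + 1))
            + p ^ (m + 1) * (1 - p ^ (k + 1)) *
              (gauss p (m + (k + 1)) k * (qPoch p p k * qPoch p p (m + 1))) := by
            rw [h3, h4]; ring
        _ = _ := by rw [ihm, h1]; ring

theorem one_sub_pow_succ_ne_zero {p : ℂ} (hp : ‖p‖ < 1) (n : ℕ) : 1 - p ^ (n + 1) ≠ 0 := by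
  intro h
  have h1 : ‖p ^ (n + 1)‖ < 1 := by
    rw [norm_pow]
    exact pow_lt_one₀ (norm_nonneg _) hp (Nat.succ_ne_zero n)
  rw [← sub_eq_zero.mp h] at h1
  simp at h1

theorem qPoch_self_ne_zero {p : ℂ} (hp : ‖p‖ < 1) (n : ℕ) : qPoch p p n ≠ 0 := by
  induction n with
  | zero => simp [qPoch]
  | succ n ih =>
    rw [qPoch_self_succ]
    exact mul_ne_zero ih (one_sub_pow_succ_ne_zero hp n)

theorem gauss_eq_div {p : ℂ} (hp : ‖p‖ < 1) {n k : ℕ} (h : k ≤ n) :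
    gauss p n k = qPoch p p n / (qPoch p p k * qPoch p p (n - k)) := by
  obtain ⟨m, rfl⟩ := Nat.exists_eq_add_of_le' h
  rw [Nat.add_sub_cancel, eq_div_iff (mul_ne_zero (qPoch_self_ne_zero hp _)
    (qPoch_self_ne_zero hp _)), gauss_mul_qPoch]

/-- The second `q`-Pascal rule. -/
theorem gauss_succ_succ' {p : ℂ} (hp : ‖p‖ < 1) (n k : ℕ) :
    gauss p (n + 1) (k + 1) = p ^ (k + 1) * gauss p n (k + 1) + gauss p n k := by
  rcases lt_trichotomy n k with h | rfl | h
  · simp [gauss_eq_zero_of_lt p h, gauss_eq_zero_of_lt p (Nat.succ_lt_succ h),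
      gauss_eq_zero_of_lt p (Nat.lt_succ_of_lt h)]
  · simp [gauss_self, gauss_eq_zero_of_lt p (Nat.lt_succ_self n)]
  · obtain ⟨m, rfl⟩ := Nat.exists_eq_add_of_le' (show k + 1 ≤ n from h)
    have h1 := gauss_mul_qPoch p m (k + 1)
    have h2 := gauss_mul_qPoch p (m + 1) k
    have h3 := qPoch_self_succ p m
    have h4 := qPoch_self_succ p k
    rw [show m + 1 + k = m + (k + 1) by omega] at h2
    have hne : qPoch p p k * qPoch p p (m + 1) ≠ 0 :=
      mul_ne_zero (qPoch_self_ne_zero hp _) (qPoch_self_ne_zero hp _)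
    rw [gauss_succ_succ, show m + (k + 1) - k = m + 1 by omega]
    refine mul_right_cancel₀ hne ?_
    rw [h4] at h1
    rw [h3] at h2 ⊢
    linear_combination (p ^ (m + 1) - 1) * h2 + (1 - p ^ (m + 1)) * h1

/-- The Pascal rule in summed form: the induction step for finite identities weighted by arbitrary
coefficients. -/
theorem sum_mul_gauss_succ (p : ℂ) (a : ℕ → ℂ) (n : ℕ) :
    ∑ k ∈ Finset.range (n + 2), a k * gauss p (n + 1) k =
      ∑ k ∈ Finset.range (n + 1), a k * gauss p n k +
        ∑ k ∈ Finset.range (n + 1), a (k + 1) * p ^ (n - k) * gauss p n k := by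
  have h := Finset.sum_range_succ (fun k => a k * gauss p n k) (n + 1)
  rw [gauss_eq_zero_of_lt p (Nat.lt_succ_self n), mul_zero, add_zero] at h
  rw [← h, Finset.sum_range_succ', Finset.sum_range_succ' (fun k => a k * gauss p n k)]
  simp only [gauss_zero_right, gauss_succ_succ, mul_add, Finset.sum_add_distrib, mul_assoc]
  ring

theorem sum_mul_gauss_succ' {p : ℂ} (hp : ‖p‖ < 1) (a : ℕ → ℂ) (n : ℕ) :
    ∑ k ∈ Finset.range (n + 2), a k * gauss p (n + 1) k =
      ∑ k ∈ Finset.range (n + 1), a k * p ^ k * gauss p n k +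
        ∑ k ∈ Finset.range (n + 1), a (k + 1) * gauss p n k := by
  have h := Finset.sum_range_succ (fun k => a k * p ^ k * gauss p n k) (n + 1)
  rw [gauss_eq_zero_of_lt p (Nat.lt_succ_self n), mul_zero, add_zero] at h
  rw [← h, Finset.sum_range_succ', Finset.sum_range_succ' (fun k => a k * p ^ k * gauss p n k)]
  simp only [gauss_zero_right, gauss_succ_succ' hp, mul_add, Finset.sum_add_distrib, mul_assoc]
  ring

/-! ### Durfee rectangle identity -/

/-- A finite form of the Durfee rectangle identity. -/
theorem sum_durfee {p : ℂ} (hp : ‖p‖ < 1) (n c : ℕ) :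
    ∑ k ∈ Finset.range (n + 1), p ^ (k ^ 2 + c * k) / qPoch p p (k + c) * gauss p n k =
      1 / qPoch p p (n + c) := by
  induction n generalizing c with
  | zero => simp [gauss_zero_right]
  | succ n ih =>
    rw [sum_mul_gauss_succ, ih]
    -- Since (k+1)² + c(k+1) + (n-k) = (n+c+1) + k² + (c+1)k, the shifted sum is the case c+1, which
    -- is why `c` is generalized.
    have h : ∑ k ∈ Finset.range (n + 1),
        p ^ ((k + 1) ^ 2 + c * (k + 1)) / qPoch p p (k + 1 + c) * p ^ (n - k) * gauss p n k =
        p ^ (n + c + 1) * ∑ k ∈ Finset.range (n + 1),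
          p ^ (k ^ 2 + (c + 1) * k) / qPoch p p (k + (c + 1)) * gauss p n k := by
      rw [Finset.mul_sum]
      refine Finset.sum_congr rfl fun k hk => ?_
      obtain ⟨d, rfl⟩ := Nat.exists_eq_add_of_le' (Nat.lt_succ_iff.mp (Finset.mem_range.mp hk))
      rw [Nat.add_sub_cancel, show k + 1 + c = k + (c + 1) by omega]
      ring
    rw [h, ih, show n + 1 + c = n + c + 1 by omega, ← add_assoc, qPoch_self_succ]
    have h1 := qPoch_self_ne_zero hp (n + c)
    have h2 := one_sub_pow_succ_ne_zero hp (n + c)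
    field_simp
    ring

theorem tendsto_qPoch (a : ℂ) {p : ℂ} (hp : ‖p‖ < 1) :
    Tendsto (qPoch a p) atTop (𝓝 (qPochInf a p)) :=
  (multipliable_qPochInf a p hp).hasProd.tendsto_prod_nat

theorem qPochInf_self_ne_zero {p : ℂ} (hp : ‖p‖ < 1) : qPochInf p p ≠ 0 := by
  have h : Summable fun n : ℕ => ‖-(p * p ^ n)‖ := by
    simpa [norm_mul, norm_pow] using
      (summable_geometric_of_lt_one (norm_nonneg p) hp).mul_left ‖p‖
  have := tprod_one_add_ne_zero_of_summable (f := fun n : ℕ => -(p * p ^ n)) (fun n => by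
    simpa [← sub_eq_add_neg, ← pow_succ'] using one_sub_pow_succ_ne_zero hp n) h
  simpa [qPochInf, sub_eq_add_neg] using this

/-- A convergent sequence with nonzero limit is bounded, and so are its inverses; this supplies the
dominating constants below. -/
theorem exists_bound_qPoch {p : ℂ} (hp : ‖p‖ < 1) :
    ∃ C : ℝ, 0 < C ∧ (∀ n, ‖qPoch p p n‖ ≤ C) ∧ ∀ n, ‖(qPoch p p n)⁻¹‖ ≤ C := by
  have h := tendsto_qPoch p hp
  obtain ⟨A, hA⟩ := (Metric.isBounded_range_of_tendsto _ h).exists_norm_le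
  obtain ⟨B, hB⟩ := (Metric.isBounded_range_of_tendsto _
    (h.inv₀ (qPochInf_self_ne_zero hp))).exists_norm_le
  refine ⟨max 1 (max A B), by positivity, fun n => ?_, fun n => ?_⟩
  · exact (hA _ ⟨n, rfl⟩).trans (by simp)
  · exact (hB _ ⟨n, rfl⟩).trans (by simp)

theorem exists_bound_gauss {p : ℂ} (hp : ‖p‖ < 1) :
    ∃ C : ℝ, ∀ n k, ‖gauss p n k‖ ≤ C := by
  obtain ⟨C, hC, h1, h2⟩ := exists_bound_qPoch hp
  refine ⟨C * (C * C), fun n k => ?_⟩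
  rcases lt_or_ge n k with h | h
  · rw [gauss_eq_zero_of_lt p h, norm_zero]; positivity
  · rw [gauss_eq_div hp h, div_eq_mul_inv, mul_inv, norm_mul, norm_mul]
    gcongr <;> simp_all

theorem tendsto_gauss {p : ℂ} (hp : ‖p‖ < 1) (k : ℕ) :
    Tendsto (fun n => gauss p n k) atTop (𝓝 (1 / qPoch p p k)) := by
  have h := tendsto_qPoch p hp
  have hne := qPochInf_self_ne_zero hp
  have hk := qPoch_self_ne_zero hp k
  have h1 : Tendsto (fun n => qPoch p p n / (qPoch p p k * qPoch p p (n - k))) atTop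
      (𝓝 (qPochInf p p / (qPoch p p k * qPochInf p p))) :=
    h.div ((h.comp (tendsto_sub_atTop_nat k)).const_mul _) (mul_ne_zero hk hne)
  rw [show 1 / qPoch p p k = qPochInf p p / (qPoch p p k * qPochInf p p) by field_simp]
  refine h1.congr' ?_
  filter_upwards [eventually_ge_atTop k] with n hn
  rw [gauss_eq_div hp hn]

/-- The Durfee rectangle identity. -/
theorem hasSum_durfee {p : ℂ} (hp : ‖p‖ < 1) (c : ℕ) :
    HasSum (fun k : ℕ => p ^ (k ^ 2 + c * k) / (qPoch p p k * qPoch p p (k + c)))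
      (1 / qPochInf p p) := by
  obtain ⟨C, hC, -, h2⟩ := exists_bound_qPoch hp
  obtain ⟨D, hD⟩ := exists_bound_gauss hp
  have hD0 : 0 ≤ D := (norm_nonneg _).trans (hD 0 0)
  have hpow : ∀ k : ℕ, ‖p‖ ^ (k ^ 2 + c * k) ≤ ‖p‖ ^ k := fun k =>
    pow_le_pow_of_le_one (norm_nonneg _) hp.le (by nlinarith [Nat.le_self_pow two_ne_zero k])
  have hgeo := summable_geometric_of_lt_one (norm_nonneg p) hp
  have hsum : Summable fun k : ℕ =>
      p ^ (k ^ 2 + c * k) / (qPoch p p k * qPoch p p (k + c)) := by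
    refine Summable.of_norm_bounded (hgeo.mul_right (C * C)) fun k => ?_
    rw [div_eq_mul_inv, mul_inv, norm_mul, norm_mul, norm_pow]
    exact mul_le_mul (hpow k) (mul_le_mul (h2 _) (h2 _) (norm_nonneg _) hC.le) (by positivity)
      (by positivity)
  have key := tendsto_tsum_of_dominated_convergence (𝓕 := atTop)
    (f := fun n k : ℕ => p ^ (k ^ 2 + c * k) / qPoch p p (k + c) * gauss p n k)
    (g := fun k => p ^ (k ^ 2 + c * k) / (qPoch p p k * qPoch p p (k + c)))
    (bound := fun k => ‖p‖ ^ k * C * D) ((hgeo.mul_right C).mul_right D)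
    (fun k => by
      have := (tendsto_gauss hp k).const_mul (p ^ (k ^ 2 + c * k) / qPoch p p (k + c))
      convert this using 2
      rw [div_mul_div_comm, mul_one, mul_comm (qPoch p p k)])
    (Eventually.of_forall fun n k => by
      rw [div_eq_mul_inv, norm_mul, norm_mul, norm_pow]
      exact mul_le_mul (mul_le_mul (hpow k) (h2 _) (norm_nonneg _) (by positivity)) (hD _ _)
        (norm_nonneg _) (by positivity))
  have hfin : ∀ n : ℕ, ∑' k : ℕ, p ^ (k ^ 2 + c * k) / qPoch p p (k + c) * gauss p n k =
      1 / qPoch p p (n + c) := fun n => by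
    rw [← sum_durfee hp, tsum_eq_sum]
    intro k hk
    rw [gauss_eq_zero_of_lt p (by simpa using hk), mul_zero]
  simp only [hfin] at key
  have hlim : Tendsto (fun n => 1 / qPoch p p (n + c)) atTop (𝓝 (1 / qPochInf p p)) :=
    tendsto_const_nhds.div ((tendsto_qPoch p hp).comp (tendsto_add_atTop_nat c))
      (qPochInf_self_ne_zero hp)
  rw [← tendsto_nhds_unique key hlim]
  exact hsum.hasSum

/-- Substituting n = k + |r| gives n² = r² + k² + 2|r|k, the Durfee series with c = 2|r|. The guard
is needed because `toNat` would truncate negative indices to 0. -/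
theorem hasSum_bailey_weight {p : ℂ} (hp : ‖p‖ < 1) (r : ℤ) :
    HasSum (fun n : ℕ => if r.natAbs ≤ n then
      p ^ (n ^ 2) / (qPoch p p (n - r).toNat * qPoch p p (n + r).toNat) else 0)
      (p ^ (r.natAbs ^ 2) / qPochInf p p) := by
  have hinj : Function.Injective fun k : ℕ => k + r.natAbs := add_left_injective _
  rw [← hinj.hasSum_iff]
  · have h := (hasSum_durfee hp (2 * r.natAbs)).mul_left (p ^ (r.natAbs ^ 2))
    rw [mul_one_div] at h
    refine h.congr_fun fun k => ?_
    have hP : qPoch p p (((k + r.natAbs : ℕ) : ℤ) - r).toNat *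
        qPoch p p (((k + r.natAbs : ℕ) : ℤ) + r).toNat =
        qPoch p p k * qPoch p p (k + 2 * r.natAbs) := by
      rcases le_total 0 r with h0 | h0
      · rw [show (((k + r.natAbs : ℕ) : ℤ) - r).toNat = k by omega,
          show (((k + r.natAbs : ℕ) : ℤ) + r).toNat = k + 2 * r.natAbs by omega]
      · rw [show (((k + r.natAbs : ℕ) : ℤ) - r).toNat = k + 2 * r.natAbs by omega,
          show (((k + r.natAbs : ℕ) : ℤ) + r).toNat = k by omega, mul_comm]
    simp only [Function.comp_apply, le_add_iff_nonneg_left, zero_le, if_true]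
    rw [hP, ← mul_div_assoc, ← pow_add]
    ring
  · intro n hn
    refine if_neg fun h => hn ⟨n - r.natAbs, ?_⟩
    simp only
    omega

/-! ### Jacobi triple product -/

/-- The general term of the theta series in the Jacobi triple product. -/
noncomputable def thetaTerm (p z : ℂ) (m : ℤ) : ℂ :=
  (-1) ^ m * z ^ m * p ^ (m * (m - 1) / 2)

theorem thetaTerm_succ {p z : ℂ} (hp : p ≠ 0) (hz : z ≠ 0) (m : ℤ) :
    thetaTerm p z (m + 1) = -(thetaTerm p z m * z * p ^ m) := by
  have h : (m + 1) * (m + 1 - 1) / 2 = m * (m - 1) / 2 + m := by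
    rw [show (m + 1) * (m + 1 - 1) = m * (m - 1) + m * 2 by ring,
      Int.add_mul_ediv_right _ _ two_ne_zero]
  rw [thetaTerm, thetaTerm, h, zpow_add₀ hp, zpow_add_one₀ hz, zpow_add_one₀ (by norm_num)]
  ring

theorem thetaTerm_ne_zero {p z : ℂ} (hp : p ≠ 0) (hz : z ≠ 0) (m : ℤ) : thetaTerm p z m ≠ 0 :=
  mul_ne_zero (mul_ne_zero (zpow_ne_zero _ (by norm_num)) (zpow_ne_zero _ hz)) (zpow_ne_zero _ hp)

/-- Reflection exchanges z and p/z, so summability over ℤ reduces to the ratio test on ℕ. -/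
theorem thetaTerm_neg {p z : ℂ} (hp : p ≠ 0) (m : ℤ) :
    thetaTerm p z (-m) = thetaTerm p (p / z) m := by
  have h : -m * (-m - 1) / 2 = m * (m - 1) / 2 + m := by
    rw [show -m * (-m - 1) = m * (m - 1) + m * 2 by ring,
      Int.add_mul_ediv_right _ _ two_ne_zero]
  rw [thetaTerm, thetaTerm, h, zpow_add₀ hp, div_zpow, zpow_neg z, zpow_neg, ← inv_zpow,
    inv_neg_one]
  ring

theorem summable_thetaTerm_nat {p z : ℂ} (hp : ‖p‖ < 1) (hp0 : p ≠ 0) (hz : z ≠ 0) :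
    Summable fun n : ℕ => thetaTerm p z n := by
  refine summable_of_ratio_test_tendsto_lt_one zero_lt_one
    (Eventually.of_forall fun n => thetaTerm_ne_zero hp0 hz n) ?_
  have h : Tendsto (fun n : ℕ => ‖z‖ * ‖p‖ ^ n) atTop (𝓝 (‖z‖ * 0)) :=
    (tendsto_pow_atTop_nhds_zero_of_lt_one (norm_nonneg p) hp).const_mul _
  rw [mul_zero] at h
  refine h.congr fun n => ?_
  rw [Nat.cast_succ, thetaTerm_succ hp0 hz, norm_neg, norm_mul, norm_mul, zpow_natCast, norm_pow]
  have := norm_ne_zero_iff.mpr (thetaTerm_ne_zero hp0 hz n)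
  field_simp

theorem summable_thetaTerm {p z : ℂ} (hp : ‖p‖ < 1) (hp0 : p ≠ 0) (hz : z ≠ 0) :
    Summable (thetaTerm p z) := by
  refine Summable.of_nat_of_neg (summable_thetaTerm_nat hp hp0 hz) ?_
  simp only [thetaTerm_neg hp0]
  exact summable_thetaTerm_nat hp hp0 (div_ne_zero hp0 hz)

/-- The finite `q`-binomial theorem. -/
theorem qPoch_eq_sum_gauss {p z : ℂ} (hp0 : p ≠ 0) (hz : z ≠ 0) (n : ℕ) :
    qPoch z p n = ∑ k ∈ Finset.range (n + 1), thetaTerm p z k * gauss p n k := by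
  induction n with
  | zero => simp [qPoch, thetaTerm, gauss_zero_right]
  | succ n ih =>
    rw [sum_mul_gauss_succ p (fun k : ℕ => thetaTerm p z k), ← ih]
    have h : ∀ k ∈ Finset.range (n + 1),
        thetaTerm p z (k + 1 : ℕ) * p ^ (n - k) * gauss p n k =
        -(z * p ^ n) * (thetaTerm p z k * gauss p n k) := fun k hk => by
      obtain ⟨d, rfl⟩ := Nat.exists_eq_add_of_le' (Nat.lt_succ_iff.mp (Finset.mem_range.mp hk))
      rw [Nat.cast_succ, thetaTerm_succ hp0 hz, Nat.add_sub_cancel, zpow_natCast, pow_add]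
      ring
    rw [Finset.sum_congr rfl h, ← Finset.mul_sum, ← ih, qPoch, Finset.prod_range_succ, ← qPoch]
    ring

/-- A finite form of the Jacobi triple product identity. -/
theorem qPoch_mul_qPoch_eq_sum_gauss {p z : ℂ} (hp : ‖p‖ < 1) (hp0 : p ≠ 0) (hz : z ≠ 0)
    (m n : ℕ) :
    qPoch z p m * qPoch (p / z) p n =
      ∑ k ∈ Finset.range (m + n + 1), thetaTerm p z (k - n) * gauss p (m + n) k := by
  induction n with
  | zero => simpa [qPoch] using qPoch_eq_sum_gauss hp0 hz m
  | succ n ih =>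
    rw [← add_assoc, sum_mul_gauss_succ' hp (fun k : ℕ => thetaTerm p z (k - (n + 1 : ℕ)))]
    have h1 : ∀ k : ℕ, thetaTerm p z ((k + 1 : ℕ) - (n + 1 : ℕ)) = thetaTerm p z (k - n) :=
      fun k => by push_cast; congr 1; ring
    -- The factor p^k from the second Pascal rule produces the new factor of (p/z; p)_{n+1}.
    have h2 : ∀ k : ℕ, thetaTerm p z (k - (n + 1 : ℕ)) * p ^ k =
        -(p / z * p ^ n) * thetaTerm p z (k - n) := fun k => by
      have := thetaTerm_succ hp0 hz ((k : ℤ) - (n + 1 : ℕ))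
      rw [show (k : ℤ) - (n + 1 : ℕ) + 1 = k - n by push_cast; ring, zpow_sub₀ hp0,
        zpow_natCast, zpow_natCast] at this
      rw [this]
      field_simp
      ring
    simp only [h1, h2, mul_assoc]
    rw [← Finset.mul_sum, ← ih, qPoch.eq_def (p / z) p (n + 1), Finset.prod_range_succ,
      ← qPoch]
    ring

/-- The Jacobi triple product identity. -/
theorem hasSum_thetaTerm {p z : ℂ} (hp : ‖p‖ < 1) (hp0 : p ≠ 0) (hz : z ≠ 0) :
    HasSum (thetaTerm p z) (qPochInf z p * qPochInf (p / z) p * qPochInf p p) := by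
  have hne := qPochInf_self_ne_zero hp
  have hsum := summable_thetaTerm hp hp0 hz
  obtain ⟨D, hD⟩ := exists_bound_gauss hp
  have hD0 : 0 ≤ D := (norm_nonneg _).trans (hD 0 0)
  have hlim : ∀ m : ℤ, Tendsto (fun n : ℕ => gauss p (n + n) (m + n).toNat) atTop
      (𝓝 (1 / qPochInf p p)) := fun m => by
    have hP := tendsto_qPoch p hp
    have t1 : Tendsto (fun n : ℕ => n + n) atTop atTop :=
      tendsto_atTop_mono (fun n => Nat.le_add_left n n) tendsto_id
    have t2 : ∀ m : ℤ, Tendsto (fun n : ℕ => (m + n).toNat) atTop atTop := fun m =>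
      tendsto_atTop_mono (fun n => by omega) (tendsto_sub_atTop_nat m.natAbs)
    have := (hP.comp t1).div ((hP.comp (t2 m)).mul (hP.comp (t2 (-m)))) (mul_ne_zero hne hne)
    rw [show 1 / qPochInf p p = qPochInf p p / (qPochInf p p * qPochInf p p) by field_simp]
    refine this.congr' ?_
    filter_upwards [eventually_ge_atTop m.natAbs] with n hn
    rw [gauss_eq_div hp (by omega), show n + n - (m + n).toNat = (-m + n).toNat by omega]
    rfl
  -- The finite sum is recentred at m = k - n and extended by zero to ℤ, so that the limit is
  -- termwise.
  have key := tendsto_tsum_of_dominated_convergence (𝓕 := atTop)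
    (f := fun (n : ℕ) (m : ℤ) => thetaTerm p z m *
      if 0 ≤ m + n then gauss p (n + n) (m + n).toNat else 0)
    (g := fun m => thetaTerm p z m * (1 / qPochInf p p))
    (bound := fun m => ‖thetaTerm p z m‖ * D) (hsum.norm.mul_right D)
    (fun m => by
      refine ((hlim m).congr' ?_).const_mul _
      filter_upwards [eventually_ge_atTop m.natAbs] with n hn
      rw [if_pos (by omega)])
    (Eventually.of_forall fun n m => by
      rw [norm_mul]
      gcongr
      split_ifs
      · exact hD _ _
      · simpa using hD0)
  have hfin : ∀ n : ℕ, ∑' m : ℤ, thetaTerm p z m *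
      (if 0 ≤ m + n then gauss p (n + n) (m + n).toNat else 0) =
      qPoch z p n * qPoch (p / z) p n := fun n => by
    rw [qPoch_mul_qPoch_eq_sum_gauss hp hp0 hz]
    have hinj : Function.Injective fun k : ℕ => (k : ℤ) - n := fun a b h => by
      simpa using h
    rw [← hinj.tsum_eq, tsum_eq_sum (s := Finset.range (n + n + 1))]
    · simp
    · intro k hk
      simp [gauss_eq_zero_of_lt p (show n + n < k by simpa using hk)]
    · intro m hm
      refine ⟨(m + n).toNat, ?_⟩
      have : 0 ≤ m + n := by
        by_contra h
        simp [h] at hm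
      simp only
      omega
  simp only [hfin] at key
  have h2 := tendsto_nhds_unique key ((tendsto_qPoch z hp).mul (tendsto_qPoch (p / z) hp))
  rw [tsum_mul_right, mul_one_div, div_eq_iff hne] at h2
  rw [← h2]
  exact hsum.hasSum

/-! ### Interchange of summation and conclusion -/

theorem thetaTerm_pow {q : ℂ} (hq0 : q ≠ 0) (a b : ℕ) (m : ℤ) :
    thetaTerm (q ^ a) (q ^ b) m = (-1) ^ m * q ^ (b * m + a * (m * (m - 1) / 2)) := by
  rw [thetaTerm, ← zpow_natCast q a, ← zpow_natCast q b, ← zpow_mul, ← zpow_mul, mul_assoc,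
    ← zpow_add₀ hq0]

/-- The terms are dominated by C²|w m||p|^n, a product of summable families; this licenses the
interchange. -/
theorem summable_theta_mul_bailey_weight {p : ℂ} (hp : ‖p‖ < 1) {w : ℤ → ℂ} (hw : Summable w)
    (r : ℤ → ℤ) :
    Summable fun x : ℤ × ℕ => w x.1 * (if (r x.1).natAbs ≤ x.2 then
      p ^ (x.2 ^ 2) / (qPoch p p (x.2 - r x.1).toNat * qPoch p p (x.2 + r x.1).toNat) else 0) := by
  obtain ⟨C, hC, -, h2⟩ := exists_bound_qPoch hp
  have hgeo := (summable_geometric_of_lt_one (norm_nonneg p) hp).mul_right (C * C)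
  refine Summable.of_norm_bounded (hw.norm.mul_of_nonneg hgeo (fun _ => norm_nonneg _)
    (fun _ => by positivity)) fun x => ?_
  rw [norm_mul]
  refine mul_le_mul_of_nonneg_left ?_ (norm_nonneg _)
  split_ifs
  · rw [div_eq_mul_inv, mul_inv, norm_mul, norm_mul, norm_pow]
    exact mul_le_mul (pow_le_pow_of_le_one (norm_nonneg _) hp.le (Nat.le_self_pow two_ne_zero _))
      (mul_le_mul (h2 _) (h2 _) (norm_nonneg _) hC.le) (by positivity) (by positivity)
  · rw [norm_zero]; positivity

theorem summand_eq {q : ℂ} (hq : ‖q‖ < 1) (hq0 : q ≠ 0) (n : ℕ) {m : ℤ}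
    (hm : (2 * m).natAbs ≤ n) :
    (-1 : ℂ) ^ m * q ^ (2 * (n : ℤ) ^ 2 + m * (9 * m + 1) / 2) / qPoch (q ^ 2) (q ^ 2) (2 * n)
        * qBinom (q ^ 2) (2 * n) ((n : ℤ) - 2 * m) =
      thetaTerm (q ^ 9) (q ^ 5) m * ((q ^ 2) ^ (n ^ 2) /
        (qPoch (q ^ 2) (q ^ 2) (n - 2 * m).toNat * qPoch (q ^ 2) (q ^ 2) (n + 2 * m).toNat)) := by
  have hp : ‖q ^ 2‖ < 1 := by
    rw [norm_pow]; exact pow_lt_one₀ (norm_nonneg _) hq two_ne_zero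
  have e : m * (9 * m + 1) / 2 = 5 * m + 9 * (m * (m - 1) / 2) := by
    obtain ⟨d, hd⟩ := (Int.even_mul_pred_self m).two_dvd
    rw [hd, Int.mul_ediv_cancel_left _ two_ne_zero,
      show m * (9 * m + 1) = 2 * (5 * m + 9 * d) by linear_combination 9 * hd,
      Int.mul_ediv_cancel_left _ two_ne_zero]
  have h1 : q ^ (2 * (n : ℤ) ^ 2) = (q ^ 2) ^ (n ^ 2) := by
    rw [← pow_mul, ← zpow_natCast]; push_cast; rfl
  rw [qBinom, if_pos (by push_cast; omega),
    show 2 * n - ((n : ℤ) - 2 * m).toNat = (n + 2 * m).toNat by omega, thetaTerm_pow hq0,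
    zpow_add₀ hq0, h1, e]
  have hne := qPoch_self_ne_zero hp
  have := hne (2 * n)
  have := hne (n - 2 * m).toNat
  have := hne (n + 2 * m).toNat
  push_cast
  field_simp

/-- m(9m+1)/2 + 8m² = m(25m+1)/2 = 13m + 25·m(m-1)/2. -/
theorem thetaTerm_mul_pow {q : ℂ} (hq0 : q ≠ 0) (m : ℤ) :
    thetaTerm (q ^ 9) (q ^ 5) m * (q ^ 2) ^ ((2 * m).natAbs ^ 2) =
      thetaTerm (q ^ 25) (q ^ 13) m := by
  have h : (q ^ 2) ^ ((2 * m).natAbs ^ 2) = q ^ (8 * m ^ 2) := by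
    rw [← pow_mul, ← zpow_natCast]
    congr 1
    push_cast
    rw [sq_abs]
    ring
  rw [thetaTerm_pow hq0, thetaTerm_pow hq0, h, mul_assoc, ← zpow_add₀ hq0]
  congr 2
  obtain ⟨d, hd⟩ := (Int.even_mul_pred_self m).two_dvd
  rw [hd, Int.mul_ediv_cancel_left _ two_ne_zero]
  push_cast
  linear_combination 8 * hd

theorem qPochInf_zero_left (p : ℂ) : qPochInf 0 p = 1 := by simp [qPochInf]

theorem mainTheorem9 (q : ℂ) (hq : ‖q‖ < 1) :
    HasSum
      (fun n : ℕ =>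
        ∑ m ∈ Finset.Icc (-((n / 2 : ℕ) : ℤ)) ((n / 2 : ℕ) : ℤ),
          (-1 : ℂ) ^ m * q ^ (2 * (n : ℤ) ^ 2 + m * (9 * m + 1) / 2)
            / qPoch (q ^ 2) (q ^ 2) (2 * n)
            * qBinom (q ^ 2) (2 * n) ((n : ℤ) - 2 * m))
      (qPochInf (q ^ 12) (q ^ 25) * qPochInf (q ^ 13) (q ^ 25) * qPochInf (q ^ 25) (q ^ 25)
        / qPochInf (q ^ 2) (q ^ 2)) := by
  have hlt : ∀ k : ℕ, k ≠ 0 → ‖q ^ k‖ < 1 := fun k hk => by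
    rw [norm_pow]; exact pow_lt_one₀ (norm_nonneg _) hq hk
  -- The theta series needs q ≠ 0 for its negative powers; at q = 0 only n = 0 contributes.
  rcases eq_or_ne q 0 with rfl | hq0
  · simp only [ne_eq, OfNat.ofNat_ne_zero, not_false_eq_true, zero_pow, qPochInf_zero_left]
    convert hasSum_single (α := ℂ) (0 : ℕ) ?_ using 1
    · simp [qPoch, qBinom]
    · intro n hn
      refine Finset.sum_eq_zero fun m _ => ?_
      have h1 : (0 : ℤ) < (n : ℤ) ^ 2 := by positivity
      have h2 : 0 ≤ m * (9 * m + 1) / 2 := Int.ediv_nonneg (by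
        rcases le_or_gt 0 m with h | h <;> nlinarith) (by norm_num)
      rw [zero_zpow _ (by omega)]
      simp
  · have hp := hlt 2 two_ne_zero
    have hsum := summable_theta_mul_bailey_weight hp
      (summable_thetaTerm (hlt 9 (by norm_num)) (pow_ne_zero 9 hq0) (pow_ne_zero 5 hq0))
      (fun m => 2 * m)
    have hrow := hsum.hasSum.prod_fiberwise fun m =>
      (hasSum_bailey_weight hp (2 * m)).mul_left (thetaTerm (q ^ 9) (q ^ 5) m)
    simp only [← mul_div_assoc, thetaTerm_mul_pow hq0] at hrow
    have hjtp := (hasSum_thetaTerm (hlt 25 (by norm_num)) (pow_ne_zero 25 hq0)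
      (pow_ne_zero 13 hq0)).div_const (qPochInf (q ^ 2) (q ^ 2))
    have hdiv : q ^ 25 / q ^ 13 = q ^ 12 := by field_simp
    rw [hdiv, mul_comm (qPochInf (q ^ 13) _)] at hjtp
    -- The total of the double series, computed by summing over n first.
    have hval := hrow.unique hjtp
    have hswap := (Equiv.prodComm ℕ ℤ).hasSum_iff.mpr hsum.hasSum
    rw [← hval]
    -- Summing over m first: the guard leaves exactly |2m| ≤ n.
    refine hswap.prod_fiberwise fun n => ?_
    rw [Finset.sum_congr rfl fun m hm => summand_eq hq hq0 n
      (by rw [Finset.mem_Icc] at hm; omega)]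
    have hF : ∀ m : ℤ, m ∈ Finset.Icc (-((n / 2 : ℕ) : ℤ)) ((n / 2 : ℕ) : ℤ) ↔
        (2 * m).natAbs ≤ n := fun m => by rw [Finset.mem_Icc]; omega
    convert hasSum_sum_of_ne_finset_zero (L := SummationFilter.unconditional ℤ)
      (s := Finset.Icc (-((n / 2 : ℕ) : ℤ)) ((n / 2 : ℕ) : ℤ)) ?_ using 1
    · exact Finset.sum_congr rfl fun m hm => congrArg _ (if_pos ((hF m).mp hm)).symm
    · exact fun m hm => mul_eq_zero_of_right _ (if_neg fun h => hm ((hF m).mpr h))
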